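/- Terminology. A coset in a group $H$ is a set $sK$ with $s\in H$ and $K\le H$ a subgroup. For a nonempty set $A\subseteq H$, $\operatorname{aff}(A)$ denotes the smallest coset containing $A$. A map $\beta\colon C\to G$ from a coset $C$ of $H$ to a group $G$ is affine if $\beta(rs^{-1}t)=\beta(r)\beta(s)^{-1}\beta(t)$ for all $r,s,t\in C$. The coset ring $\Omega(H)$ is the smallest family of subsets of $H$ containing all cosets and closed under finite unions, finite intersections and complements in $H$; if $H$ is a topological group, the open coset ring $\Omega_o(H)$ is the family generated in the same way by the open cosets. A map $\alpha\colon Y\to G$ with $Y\subseteq H$ is piecewise affine if $Y$ is a finite disjoint union of nonempty sets $Y_i\in\Omega(H)$ such that for each $i$ there is an affine map $\operatorname{aff}(Y_i)\to G$ that agrees with $\alpha$ on $Y_i$. Proposition 4.6. Let $G$ and $H$ be locally compact Hausdorff groups with $H$ $\sigma$-compact. Let $G_\infty=G\cup\{\infty\}$ be the one-point compactification of $G$ if $G$ is not compact, and the topological disjoint union $G\sqcup\{\infty\}$ if $G$ is compact. Let $\alpha\colon H\to G_\infty$ be continuous, put $Y=\alpha^{-1}(G)$, and suppose that the restriction $\alpha\colon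 Y\to G$ is piecewise affine (with $H$ and $G$ regarded as groups without topology). Then there are finitely many pairwise disjoint nonempty sets $Y_1,\dots,Y_m$ in the open coset ring $\Omega_o(H)$ with $Y=Y_1\cup\dots\cup Y_m$ (where $m=0$ if $Y=\emptyset$), and for each $i$ there is a continuous affine map $\alpha_i\colon\operatorname{aff}(Y_i)\to G$ that agrees with $\alpha$ on $Y_i$. -/

import Mathlib

open scoped Pointwise

/-- `C` is a coset of some subgroup: `C = s K`. (Right cosets are also of this form, since
`K s = s (s⁻¹ K s)`.) -/
def IsCosetSet {H : Type*} [Group H] (C : Set H) : Prop :=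
  ∃ (s : H) (K : Subgroup H), C = s • (K : Set H)

/-- `aff(A)`: the intersection of all cosets that contain `A`. For nonempty `A` this is the
smallest coset containing `A`, see `isLeast_affHull`. -/
def affHull {H : Type*} [Group H] (A : Set H) : Set H :=
  ⋂₀ {C : Set H | IsCosetSet C ∧ A ⊆ C}

theorem subset_affHull {H : Type*} [Group H] (A : Set H) : A ⊆ affHull A :=
  Set.subset_sInter fun _ hC => hC.2

theorem isLeast_affHull {H : Type*} [Group H] {A : Set H} (hA : A.Nonempty) :
    IsLeast {C : Set H | IsCosetSet C ∧ A ⊆ C} (affHull A) := by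
  obtain ⟨a, ha⟩ := hA
  refine ⟨⟨⟨a, sInf {K : Subgroup H | A ⊆ a • (K : Set H)}, ?_⟩, subset_affHull A⟩,
    fun C hC => Set.sInter_subset_of_mem hC⟩
  ext x
  simp only [affHull, Set.mem_sInter, Set.mem_ofPred_eq, Set.mem_smul_set_iff_inv_smul_mem,
    smul_eq_mul, SetLike.mem_coe, Subgroup.mem_sInf]
  constructor
  · intro h K hK
    have := h (a • (K : Set H)) ⟨⟨a, K, rfl⟩, hK⟩
    simpa [Set.mem_smul_set_iff_inv_smul_mem] using this
  · rintro h C ⟨⟨s, K, rfl⟩, hC⟩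
    have hs : s • (K : Set H) = a • (K : Set H) := by
      have h1 := hC ha
      rw [Set.mem_smul_set_iff_inv_smul_mem] at h1
      exact (leftCoset_eq_iff K).2 h1
    rw [hs] at hC ⊢
    simpa [Set.mem_smul_set_iff_inv_smul_mem] using h K hC

/-- The coset ring `Ω(H)`: the smallest family of subsets of `H` that contains all cosets and is
closed under finite unions, finite intersections and complements in `H`. -/
def cosetRing (H : Type*) [Group H] : Set (Set H) :=
  MeasureTheory.generateSetAlgebra {C : Set H | IsCosetSet C}

/-- The open coset ring `Ω_o(H)`: generated in the same way by the open cosets. -/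
def openCosetRing (H : Type*) [Group H] [TopologicalSpace H] : Set (Set H) :=
  MeasureTheory.generateSetAlgebra {C : Set H | IsCosetSet C ∧ IsOpen C}

/-- A map `β` on a coset `C` is affine if `β (r s⁻¹ t) = β(r) β(s)⁻¹ β(t)` for `r, s, t ∈ C`
(here `u` stands for the element `r s⁻¹ t`, which again lies in the coset `C`). -/
def IsAffineMap {H G : Type*} [Group H] [Group G] {C : Set H} (β : C → G) : Prop :=
  ∀ r s t u : C, (u : H) = (r : H) * (s : H)⁻¹ * (t : H) → β u = β r * (β s)⁻¹ * β t

/-- The map `a : Y ⊆ H → G` is piecewise affine; no topology is involved. -/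
def IsPiecewiseAffine {H G : Type*} [Group H] [Group G] {Y : Set H} (a : Y → G) : Prop :=
  ∃ (n : ℕ) (P : Fin n → Set H),
    (∀ i, P i ∈ cosetRing H) ∧ Pairwise (fun i j => Disjoint (P i) (P j)) ∧ Y = ⋃ i, P i ∧
    ∀ i, ∃ β : affHull (P i) → G, IsAffineMap β ∧
      ∀ (y : H) (hy : y ∈ Y) (hP : y ∈ P i), a ⟨y, hy⟩ = β ⟨y, subset_affHull _ hP⟩

/-! A set in the coset ring is a finite union of cosets `x • M` minus finitely many cosets `b • K`.
If `M` is nowhere dense, the piece is negligible. Otherwise `closure M` is open, and the removed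
cosets matter according to the index of `K` in `M` near `1`. Subgroups of locally finite index are
eliminated by splitting along open cosets (`coset_sdiff`). By a local Neumann lemma, removing the
others leaves a set dense in `x • M` within its open part `O`. On such a piece the affine map is
continuous because `α` is. Its affine identity carries continuity at one point over to a Cauchy
condition everywhere, so it extends to an affine map on the open coset `closure (x • M)`. By density
it agrees with `α` on `O ∩ closure (x • M)`. These sets are clopen and finite in number, so what
they miss of the open set `Y` is open and covered by finitely many nowhere dense sets, hence empty.
-/

open Topology Filter

/-! ### Locally finite index and a local Neumann lemma. -/

/-- Some neighbourhood of `1` in `M` is covered by finitely many left cosets of `K`. -/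
def IsLocallyFiniteIndex {H : Type*} [Group H] [TopologicalSpace H] (M K : Subgroup H) : Prop :=
  ∃ V ∈ 𝓝 (1 : H), ∃ T : Finset H, ∀ v ∈ V, v ∈ M → ∃ t ∈ T, t⁻¹ * v ∈ K

/-- A local version of B. H. Neumann's lemma. -/
theorem exists_isLocallyFiniteIndex {H : Type*} [Group H] [TopologicalSpace H]
    [IsTopologicalGroup H] (M : Subgroup H) (S : Finset (Subgroup H)) :
    ∀ V ∈ 𝓝 (1 : H), ∀ T : Finset H,
      (∀ v ∈ V, v ∈ M → ∃ K ∈ S, ∃ t ∈ T, t⁻¹ * v ∈ K) → ∃ K ∈ S, IsLocallyFiniteIndex M K := by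
  classical
  induction S using Finset.induction_on with
  | empty =>
    intro V hV T h
    obtain ⟨K, hK, -⟩ := h 1 (mem_of_mem_nhds hV) M.one_mem
    simp at hK
  | insert K S _ ih =>
    intro V hV T h
    have hmul : Tendsto (fun p : H × H × H => p.1 * p.2.1⁻¹ * p.2.2) (𝓝 (1, 1, 1)) (𝓝 1) :=
      Continuous.tendsto' (by fun_prop) _ _ (by simp)
    have hmem := hmul hV
    rw [nhds_prod_eq, nhds_prod_eq] at hmem
    obtain ⟨A, hA, B, hB, hAB⟩ := Filter.mem_prod_iff.1 (Filter.mem_map.1 hmem)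
    obtain ⟨B₁, hB₁, B₂, hB₂, hBB⟩ := Filter.mem_prod_iff.1 hB
    set W := A ∩ (B₁ ∩ B₂) with hW_def
    have hW : W ∈ 𝓝 (1 : H) := inter_mem hA (inter_mem hB₁ hB₂)
    have hWV : ∀ x ∈ W, ∀ y ∈ W, ∀ z ∈ W, x * y⁻¹ * z ∈ V := fun x hx y hy z hz =>
      @hAB (x, y, z) ⟨hx.1, hBB (Set.mk_mem_prod hy.2.1 hz.2.2)⟩
    by_cases hK : ∀ v ∈ W, v ∈ M → ∃ t ∈ T, t⁻¹ * v ∈ K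
    · exact ⟨K, Finset.mem_insert_self _ _, W, hW, T, hK⟩
    · push Not at hK
      -- The coset `xK` misses every `sK` with `s ∈ T`. For `z ∈ tK` near `1` and a fixed
      -- representative `y t` of `tK`, the point `x (y t)⁻¹ z` lies in `xK`, so a subgroup from `S`
      -- must cover it. Translating back covers `z` without using `K`.
      obtain ⟨x, hxW, hxM, hx⟩ := hK
      have hrep : ∀ t : H, ∃ y : H, ∀ z ∈ W, z ∈ M → t⁻¹ * z ∈ K →
          y ∈ W ∧ y ∈ M ∧ t⁻¹ * y ∈ K := by
        intro t
        by_cases ht : ∃ y, y ∈ W ∧ y ∈ M ∧ t⁻¹ * y ∈ K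
        · obtain ⟨y, hy⟩ := ht
          exact ⟨y, fun _ _ _ _ => hy⟩
        · exact ⟨1, fun z h₁ h₂ h₃ => (ht ⟨z, h₁, h₂, h₃⟩).elim⟩
      choose y hy using hrep
      obtain ⟨K', hK', hfin⟩ := ih W hW
        (T ∪ (T ×ˢ T).image fun p => y p.1 * x⁻¹ * p.2) (by
          intro z hzW hzM
          obtain ⟨K', hK', t, ht, htz⟩ := h z (by
            simpa using hWV z hzW z hzW z hzW) hzM
          rcases Finset.mem_insert.1 hK' with rfl | hK'
          · obtain ⟨hyW, hyM, hyK⟩ := hy t z hzW hzM htz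
            have hyz : (y t)⁻¹ * z ∈ K' := by
              simpa [mul_assoc] using K'.mul_mem (K'.inv_mem hyK) htz
            obtain ⟨K'', hK'', s, hs, hsz⟩ := h (x * (y t)⁻¹ * z)
              (hWV x hxW _ hyW z hzW) (M.mul_mem (M.mul_mem hxM (M.inv_mem hyM)) hzM)
            rcases Finset.mem_insert.1 hK'' with rfl | hK''
            · refine (hx s hs ?_).elim
              simpa [mul_assoc] using K''.mul_mem hsz (K''.inv_mem hyz)
            · refine ⟨K'', hK'', y t * x⁻¹ * s, ?_, by simpa [mul_assoc] using hsz⟩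
              exact Finset.mem_union_right _
                (Finset.mem_image.2 ⟨(t, s), Finset.mk_mem_product ht hs, rfl⟩)
          · exact ⟨K', hK', t, Finset.mem_union_left _ ht, htz⟩)
      exact ⟨K', Finset.mem_insert_of_mem hK', hfin⟩

/-- Contrapositive of the local Neumann lemma, translated to `x`: finitely many cosets of locally
infinite index cannot fill `x • M` near `x`. -/
theorem exists_mem_nhds_forall_notMem {H : Type*} [Group H] [TopologicalSpace H]
    [IsTopologicalGroup H] {M : Subgroup H} {S : Finset (Subgroup H)}
    (hS : ∀ K ∈ S, ¬ IsLocallyFiniteIndex M K) (T : Finset H) {x : H} {U : Set H} (hU : U ∈ 𝓝 x) :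
    ∃ y ∈ U, x⁻¹ * y ∈ M ∧ ∀ K ∈ S, ∀ t ∈ T, t⁻¹ * y ∉ K := by
  classical
  by_contra! hcon
  obtain ⟨K, hK, hfin⟩ := exists_isLocallyFiniteIndex M S ((x * ·) ⁻¹' U)
    ((continuous_const_mul x).tendsto' 1 x (mul_one x) hU) (T.image (x⁻¹ * ·)) (by
      intro v hv hvM
      obtain ⟨K, hK, t, ht, hKt⟩ := hcon (x * v) hv (by simpa using hvM)
      exact ⟨K, hK, x⁻¹ * t, Finset.mem_image_of_mem _ ht, by simpa [mul_assoc] using hKt⟩)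
  exact hS K hK hfin

/-! ### Finite covers by closed sets and open closures of subgroups. -/

theorem exists_interior_nonempty_of_subset_biUnion {X ι : Type*} [TopologicalSpace X]
    (s : Finset ι) {F : ι → Set X} (hF : ∀ i ∈ s, IsClosed (F i)) :
    ∀ {U : Set X}, IsOpen U → U.Nonempty → U ⊆ ⋃ i ∈ s, F i →
      ∃ i ∈ s, (interior (F i)).Nonempty := by
  classical
  induction s using Finset.induction_on with
  | empty =>
    rintro U - ⟨x, hx⟩ h
    simpa using h hx
  | insert i s _ ih =>
    intro U hU hne h
    by_cases hUi : U ⊆ F i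
    · exact ⟨i, Finset.mem_insert_self _ _, hne.mono (interior_maximal hUi hU)⟩
    · obtain ⟨j, hj, hjF⟩ := ih (fun j hj => hF j (Finset.mem_insert_of_mem hj))
        (U := U \ F i) (hU.sdiff (hF i (Finset.mem_insert_self _ _)))
        (Set.sdiff_nonempty.2 hUi) (by
          rintro x ⟨hxU, hxi⟩
          have := h hxU
          simp only [Finset.mem_insert, Set.iUnion_iUnion_eq_or_left, Set.mem_union] at this
          exact this.resolve_left hxi)
      exact ⟨j, Finset.mem_insert_of_mem hj, hjF⟩

theorem isOpen_closure_of_interior_smul {H : Type*} [Group H] [TopologicalSpace H]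
    [IsTopologicalGroup H] (K : Subgroup H) (t : H)
    (h : (interior (closure (t • (K : Set H)))).Nonempty) : IsOpen (closure (K : Set H)) := by
  obtain ⟨x, hx⟩ := h
  rw [closure_smul, interior_smul, Set.mem_smul_set_iff_inv_smul_mem] at hx
  exact K.topologicalClosure.isOpen_of_mem_nhds (mem_interior_iff_mem_nhds.1 hx)

/-- If `K` has locally finite index in `M` and `M` is dense in an open set, then the closure of
`K ⊓ M` is open and `K ⊓ M` has finite index in its intersection with `M`. -/
theorem IsLocallyFiniteIndex.isOpen_closure {H : Type*} [Group H] [TopologicalSpace H]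
    [IsTopologicalGroup H] {M K : Subgroup H} (h : IsLocallyFiniteIndex M K)
    (hM : IsOpen (closure (M : Set H))) :
    IsOpen (closure ((K ⊓ M : Subgroup H) : Set H)) ∧
      ∃ T : Finset H, ∀ m ∈ M, m ∈ closure ((K ⊓ M : Subgroup H) : Set H) →
        ∃ t ∈ T, t⁻¹ * m ∈ K ⊓ M := by
  classical
  obtain ⟨V, hV, T, hT⟩ := h
  -- Moving each representative into `M` turns cosets of `K` into cosets of `K ⊓ M`.
  have hrep : ∀ t : H, ∃ y : H, ∀ z ∈ M, t⁻¹ * z ∈ K → y⁻¹ * z ∈ K ⊓ M := by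
    intro t
    by_cases ht : ∃ y, y ∈ M ∧ t⁻¹ * y ∈ K
    · obtain ⟨y, hyM, hyK⟩ := ht
      exact ⟨y, fun z hzM hzK => ⟨by simpa [mul_assoc] using K.mul_mem (K.inv_mem hyK) hzK,
        M.mul_mem (M.inv_mem hyM) hzM⟩⟩
    · exact ⟨1, fun z h₁ h₂ => (ht ⟨z, h₁, h₂⟩).elim⟩
  choose y hy using hrep
  have hT' : ∀ v ∈ V, v ∈ M → ∃ t ∈ T.image y, t⁻¹ * v ∈ K ⊓ M := by
    intro v hv hvM
    obtain ⟨t, ht, htv⟩ := hT v hv hvM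
    exact ⟨y t, Finset.mem_image_of_mem _ ht, hy t v hvM htv⟩
  constructor
  · have hsub : interior V ∩ closure (M : Set H) ⊆
        ⋃ t ∈ T.image y, closure (t • ((K ⊓ M : Subgroup H) : Set H)) := by
      refine (isOpen_interior.inter_closure).trans ?_
      rw [← Finset.closure_biUnion]
      refine closure_mono fun v ⟨hvV, hvM⟩ => ?_
      obtain ⟨t, ht, htv⟩ := hT' v (interior_subset hvV) hvM
      simp only [Set.mem_iUnion]
      exact ⟨t, ht, Set.mem_smul_set_iff_inv_smul_mem.2 htv⟩
    obtain ⟨t, -, ht⟩ := exists_interior_nonempty_of_subset_biUnion _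
      (fun _ _ => isClosed_closure) (isOpen_interior.inter hM)
      ⟨1, mem_interior_iff_mem_nhds.2 hV, subset_closure M.one_mem⟩ hsub
    exact isOpen_closure_of_interior_smul (K ⊓ M) t ht
  -- A point `m` of the closure is moved into `V` by right multiplication with some `k⁻¹`, `k ∈ K ⊓
  -- M`, which does not change its left coset.
  · refine ⟨T.image y, fun m hm hmc => ?_⟩
    have hnhds : (fun k => m * k⁻¹) ⁻¹' V ∈ 𝓝 m :=
      (show Continuous fun k => m * k⁻¹ by fun_prop).tendsto' m 1 (by simp) hV
    obtain ⟨k, hkV, hk⟩ := mem_closure_iff_nhds.1 hmc _ hnhds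
    obtain ⟨t, ht, htm⟩ := hT' (m * k⁻¹) hkV (M.mul_mem hm (M.inv_mem hk.2))
    exact ⟨t, ht, by simpa [mul_assoc] using (K ⊓ M).mul_mem htm hk⟩

/-! ### Decomposition into reduced pieces. -/

/-- An open-coset-ring part of a left coset `x • M` inside `E`, with finitely many left cosets
removed. If `M` is somewhere dense, the subgroups removed are of locally infinite index in `M`. -/
def IsReducedPiece {H : Type*} [Group H] [TopologicalSpace H] (E S : Set H) : Prop :=
  ∃ O ∈ openCosetRing H, ∃ (x : H) (M : Subgroup H) (J : Finset (H × Subgroup H)),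
    x • (M : Set H) ⊆ E ∧ S = (O ∩ x • (M : Set H)) \ ⋃ p ∈ J, p.1 • (p.2 : Set H) ∧
    (IsOpen (closure (M : Set H)) → ∀ p ∈ J, ¬ IsLocallyFiniteIndex M p.2)

/-- `S` is a finite union of reduced pieces inside `E`. -/
def HasReducedDecomposition {H : Type*} [Group H] [TopologicalSpace H] (E S : Set H) : Prop :=
  ∃ F : Set (Set H), F.Finite ∧ (∀ A ∈ F, IsReducedPiece E A) ∧ S = ⋃₀ F

namespace HasReducedDecomposition

variable {H : Type*} [Group H] [TopologicalSpace H] {E : Set H}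

theorem of_isReducedPiece {S : Set H} (h : IsReducedPiece E S) : HasReducedDecomposition E S :=
  ⟨{S}, Set.finite_singleton S, by simpa using h, by simp⟩

theorem biUnion {ι : Type*} {s : Set ι} (hs : s.Finite) {f : ι → Set H}
    (h : ∀ i ∈ s, HasReducedDecomposition E (f i)) :
    HasReducedDecomposition E (⋃ i ∈ s, f i) := by
  choose! F hfin hF hU using h
  refine ⟨⋃ i ∈ s, F i, hs.biUnion hfin, ?_, ?_⟩
  · simp only [Set.mem_iUnion]
    rintro A ⟨i, hi, hA⟩
    exact hF i hi A hA
  · simp only [Set.sUnion_iUnion]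
    exact Set.iUnion₂_congr hU

theorem union {S T : Set H} (hS : HasReducedDecomposition E S)
    (hT : HasReducedDecomposition E T) : HasReducedDecomposition E (S ∪ T) := by
  obtain ⟨F, hF, hFr, rfl⟩ := hS
  obtain ⟨F', hF', hFr', rfl⟩ := hT
  refine ⟨F ∪ F', hF.union hF', ?_, (Set.sUnion_union F F').symm⟩
  rintro A (hA | hA)
  exacts [hFr A hA, hFr' A hA]

/-- Induction on `J`, for all `M` at once. With `z` common to both cosets and `L` the open closure
of `K ⊓ M`, removing `z • K` is automatic outside `z • L`. Inside `z • L` there remain finitely many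
cosets `(z * t) • (K ⊓ M)` with `t ∉ K`. Both parts need one coset fewer removed. -/
theorem coset_sdiff [IsTopologicalGroup H] (J : Finset (H × Subgroup H)) :
    ∀ O ∈ openCosetRing H, ∀ (x : H) (M : Subgroup H), x • (M : Set H) ⊆ E →
      HasReducedDecomposition E ((O ∩ x • (M : Set H)) \ ⋃ p ∈ J, p.1 • (p.2 : Set H)) := by
  classical
  induction J using Finset.strongInduction with
  | H J ih =>
  intro O hO x M hME
  by_cases hgood : IsOpen (closure (M : Set H)) → ∀ p ∈ J, ¬ IsLocallyFiniteIndex M p.2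
  · exact of_isReducedPiece ⟨O, hO, x, M, J, hME, rfl, hgood⟩
  push Not at hgood
  obtain ⟨hM, ⟨b, K⟩, hp, hfin⟩ := hgood
  have ih' := ih (J.erase (b, K)) (Finset.erase_ssubset hp)
  have hJ : (⋃ p ∈ J, p.1 • (p.2 : Set H)) =
      b • (K : Set H) ∪ ⋃ p ∈ J.erase (b, K), p.1 • (p.2 : Set H) := by
    conv_lhs => rw [← Finset.insert_erase hp]
    rw [Finset.set_biUnion_insert]
  by_cases hdisj : Disjoint (x • (M : Set H)) (b • (K : Set H))
  · have h := ih' O hO x M hME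
    convert h using 1
    rw [hJ]
    ext y
    have : y ∈ x • (M : Set H) → y ∉ b • (K : Set H) := fun h => Set.disjoint_left.1 hdisj h
    simp only [Set.mem_sdiff, Set.mem_inter_iff, Set.mem_union]
    tauto
  obtain ⟨z, hzM, hzK⟩ := Set.not_disjoint_iff.1 hdisj
  rw [Set.mem_smul_set_iff_inv_smul_mem] at hzM hzK
  have hxz : x • (M : Set H) = z • (M : Set H) := (leftCoset_eq_iff M).2 hzM
  have hbz : b • (K : Set H) = z • (K : Set H) := (leftCoset_eq_iff K).2 hzK
  obtain ⟨hopen, T, hT⟩ := hfin.isOpen_closure hM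
  set L : Set H := closure ((K ⊓ M : Subgroup H) : Set H) with hL
  have hzL : z • L ∈ openCosetRing H :=
    MeasureTheory.self_subset_generateSetAlgebra
      ⟨⟨z, (K ⊓ M).topologicalClosure, rfl⟩, hopen.smul z⟩
  have hA := MeasureTheory.isSetAlgebra_generateSetAlgebra
    (𝒜 := {C : Set H | IsCosetSet C ∧ IsOpen C})
  have h₁ := ih' (O \ z • L) (hA.sdiff_mem hO hzL) x M hME
  have h₂ : HasReducedDecomposition E (⋃ t ∈ {t : H | t ∈ T ∧ t ∈ M ∧ t ∉ K},
      ((O ∩ (z * t) • ((K ⊓ M : Subgroup H) : Set H)) \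
        ⋃ p ∈ J.erase (b, K), p.1 • (p.2 : Set H))) := by
    refine biUnion (T.finite_toSet.subset fun t ht => ht.1) fun t ht => ih' O hO _ _ ?_
    refine subset_trans ?_ (hxz ▸ hME)
    intro y hy
    rw [Set.mem_smul_set_iff_inv_smul_mem] at hy ⊢
    have := M.mul_mem ht.2.1 hy.2
    simpa [mul_assoc] using this
  convert h₁.union h₂ using 1
  rw [hJ, hbz, hxz]
  ext y
  simp only [Set.mem_sdiff, Set.mem_inter_iff, Set.mem_union, Set.mem_iUnion₂, exists_prop,
    Set.mem_ofPred_eq, Set.mem_smul_set_iff_inv_smul_mem, smul_eq_mul, SetLike.mem_coe,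
    mul_inv_rev, Subgroup.mem_inf]
  constructor
  · rintro ⟨⟨hyO, hyM⟩, hyn⟩
    rw [not_or] at hyn
    by_cases hyL : z⁻¹ * y ∈ L
    · right
      obtain ⟨t, ht, htK, htM⟩ := hT _ hyM hyL
      refine ⟨t, ⟨ht, ?_, fun htK' => hyn.1 ?_⟩, ⟨hyO, ?_, ?_⟩, hyn.2⟩
      · simpa [mul_assoc] using M.mul_mem hyM (M.inv_mem htM)
      · simpa using K.mul_mem htK' htK
      · simpa [mul_assoc] using htK
      · simpa [mul_assoc] using htM
    · exact Or.inl ⟨⟨⟨hyO, hyL⟩, hyM⟩, hyn.2⟩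
  · rintro (⟨⟨⟨hyO, hyL⟩, hyM⟩, hyn⟩ | ⟨t, ⟨-, htM, htK⟩, ⟨hyO, hyK, hyM⟩, hyn⟩)
    · exact ⟨⟨hyO, hyM⟩, not_or.2 ⟨fun hyK => hyL (subset_closure ⟨hyK, hyM⟩), hyn⟩⟩
    · refine ⟨⟨hyO, ?_⟩, not_or.2 ⟨fun hyK' => htK ?_, hyn⟩⟩
      · simpa [mul_assoc] using M.mul_mem htM hyM
      · have := K.mul_mem hyK' (K.inv_mem hyK)
        simpa [mul_assoc] using this

end HasReducedDecomposition

theorem IsCosetSet.univ {H : Type*} [Group H] : IsCosetSet (Set.univ : Set H) :=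
  ⟨1, ⊤, by simp⟩

theorem IsCosetSet.inter {H : Type*} [Group H] {C D : Set H} (hC : IsCosetSet C)
    (hD : IsCosetSet D) (h : (C ∩ D).Nonempty) : IsCosetSet (C ∩ D) := by
  obtain ⟨s, K, rfl⟩ := hC
  obtain ⟨t, L, rfl⟩ := hD
  obtain ⟨z, hzK, hzL⟩ := h
  rw [Set.mem_smul_set_iff_inv_smul_mem] at hzK hzL
  refine ⟨z, K ⊓ L, ?_⟩
  rw [(leftCoset_eq_iff K).2 hzK, (leftCoset_eq_iff L).2 hzL, Subgroup.coe_inf,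
    Set.smul_set_inter]

/-- Cosets shrink `x • M` to a smaller coset or to nothing; complements of cosets accumulate in `J`.
-/
theorem exists_biInter_inter_eq_coset_sdiff {H : Type*} [Group H] {E : Set H} (hE : IsCosetSet E)
    {A : Set (Set H)} (hA : A.Finite) (hAc : ∀ t ∈ A, IsCosetSet t ∨ IsCosetSet tᶜ) :
    (⋂ t ∈ A, t) ∩ E = ∅ ∨ ∃ (x : H) (M : Subgroup H) (J : Finset (H × Subgroup H)),
      x • (M : Set H) ⊆ E ∧
      (⋂ t ∈ A, t) ∩ E = x • (M : Set H) \ ⋃ p ∈ J, p.1 • (p.2 : Set H) := by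
  classical
  induction A, hA using Set.Finite.induction_on with
  | empty =>
    obtain ⟨x, M, rfl⟩ := hE
    exact Or.inr ⟨x, M, ∅, subset_rfl, by simp⟩
  | @insert B A _ _ ih =>
    rw [Set.biInter_insert, Set.inter_assoc]
    rcases ih fun t ht => hAc t (Set.mem_insert_of_mem _ ht) with h | ⟨x, M, J, hsub, h⟩
    · left
      rw [h, Set.inter_empty]
    rw [h]
    rcases hAc B (Set.mem_insert _ _) with hB | ⟨b, K, hB⟩
    · rcases Set.eq_empty_or_nonempty (B ∩ x • (M : Set H)) with hemp | hne
      · left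
        rw [← Set.inter_sdiff_assoc, hemp, Set.empty_sdiff]
      · obtain ⟨y, N, hN⟩ := hB.inter ⟨x, M, rfl⟩ hne
        exact Or.inr ⟨y, N, J, hN ▸ Set.inter_subset_right.trans hsub, by
          rw [← hN, Set.inter_sdiff_assoc]⟩
    · refine Or.inr ⟨x, M, insert (b, K) J, hsub, ?_⟩
      rw [Finset.set_biUnion_insert, ← hB]
      ext y
      simp only [Set.mem_inter_iff, Set.mem_sdiff, Set.mem_union, Set.mem_compl_iff]
      tauto

theorem hasReducedDecomposition_of_mem_cosetRing {H : Type*} [Group H] [TopologicalSpace H]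
    [IsTopologicalGroup H] {E X : Set H} (hX : X ∈ cosetRing H) (hE : IsCosetSet E)
    (hXE : X ⊆ E) : HasReducedDecomposition E X := by
  obtain ⟨A, hA, hAfin, hAc, hU⟩ := MeasureTheory.mem_generateSetAlgebra_elim hX
  have hXU : X = ⋃ a ∈ A, (⋂ t ∈ a, t) ∩ E := by
    rw [← Set.iUnion₂_inter, ← hU, Set.inter_eq_left.2 hXE]
  rw [hXU]
  refine .biUnion hA fun a ha => ?_
  rcases exists_biInter_inter_eq_coset_sdiff hE (hAfin a ha) (hAc a ha) with
    h | ⟨x, M, J, hsub, h⟩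
  · rw [h]
    exact ⟨∅, Set.finite_empty, by simp, by simp⟩
  · rw [h, ← Set.univ_inter (x • (M : Set H))]
    exact .coset_sdiff J Set.univ
      MeasureTheory.isSetAlgebra_generateSetAlgebra.univ_mem x M hsub

/-! ### Continuous extension of affine maps. -/

/-- `f` restricts to an affine map on `C`. -/
def IsAffineOn {H G : Type*} [Group H] [Group G] (f : H → G) (C : Set H) : Prop :=
  ∀ r ∈ C, ∀ s ∈ C, ∀ t ∈ C, f (r * s⁻¹ * t) = f r * (f s)⁻¹ * f t

theorem IsAffineOn.mono {H G : Type*} [Group H] [Group G] {f : H → G} {C D : Set H}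
    (hf : IsAffineOn f D) (h : C ⊆ D) : IsAffineOn f C :=
  fun r hr s hs t ht => hf r (h hr) s (h hs) t (h ht)

theorem IsCosetSet.mul_inv_mul_mem {H : Type*} [Group H] {C : Set H} (hC : IsCosetSet C)
    {r s t : H} (hr : r ∈ C) (hs : s ∈ C) (ht : t ∈ C) : r * s⁻¹ * t ∈ C := by
  obtain ⟨x, M, rfl⟩ := hC
  rw [Set.mem_smul_set_iff_inv_smul_mem] at *
  have := M.mul_mem (M.mul_mem hr (M.inv_mem hs)) ht
  simpa [mul_assoc] using this

theorem IsAffineMap.isAffineOn {H G : Type*} [Group H] [Group G] {C : Set H} (hC : IsCosetSet C)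
    {β : C → G} (hβ : IsAffineMap β) {f : H → G} (hf : ∀ c : C, f c = β c) : IsAffineOn f C := by
  intro r hr s hs t ht
  have hu := hC.mul_inv_mul_mem hr hs ht
  rw [hf ⟨r, hr⟩, hf ⟨s, hs⟩, hf ⟨t, ht⟩, hf ⟨_, hu⟩]
  exact hβ ⟨r, hr⟩ ⟨s, hs⟩ ⟨t, ht⟩ ⟨_, hu⟩ rfl

section

variable {H G : Type*} [Group H] [TopologicalSpace H] [IsTopologicalGroup H]
  [Group G] [TopologicalSpace G] [IsTopologicalGroup G]

/-- A locally compact group is complete for its right uniformity. -/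
theorem exists_tendsto_of_tendsto_div [LocallyCompactSpace G] {ι : Type*} {F : Filter ι} [F.NeBot]
    {f : ι → G} (h : Tendsto (fun p : ι × ι => f p.2 / f p.1) (F ×ˢ F) (𝓝 1)) :
    ∃ g, Tendsto f F (𝓝 g) := by
  let := IsTopologicalGroup.rightUniformSpace G
  have : IsRightUniformGroup G := { uniformity_eq := rfl }
  have : CompleteSpace G := IsRightUniformGroup.completeSpace_of_weaklyLocallyCompactSpace
  refine CompleteSpace.complete (f := map f F) ?_
  rw [cauchy_map_iff]
  refine ⟨inferInstance, ?_⟩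
  rw [uniformity_eq_comap_nhds_one, tendsto_comap_iff]
  exact h

variable {O : Set H} {x : H} {M : Subgroup H} {J : Finset (H × Subgroup H)}

/-- A reduced piece is dense in the open part of its coset, even simultaneously with one of its
left translates. -/
theorem exists_mem_sdiff_and_mul_mem_sdiff (hJ : ∀ p ∈ J, ¬ IsLocallyFiniteIndex M p.2)
    {y₀ n : H} (hy₀ : y₀ ∈ x • (M : Set H)) (hn : n * y₀ ∈ x • (M : Set H)) {U : Set H}
    (hU : U ∈ 𝓝 y₀) (hUO : ∀ y ∈ U, y ∈ O ∧ n * y ∈ O) :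
    ∃ y ∈ U, y ∈ (O ∩ x • (M : Set H)) \ ⋃ p ∈ J, p.1 • (p.2 : Set H) ∧
      n * y ∈ (O ∩ x • (M : Set H)) \ ⋃ p ∈ J, p.1 • (p.2 : Set H) := by
  classical
  obtain ⟨y, hyU, hyM, hy⟩ := exists_mem_nhds_forall_notMem (M := M) (S := J.image Prod.snd)
    (by simpa using fun K b hb => hJ (b, K) hb)
    -- `n * y` avoids `b • K` exactly when `y` avoids `(n⁻¹ * b) • K`.
    (J.image Prod.fst ∪ J.image fun p => n⁻¹ * p.1) hU
  have hK : ∀ p ∈ J, p.1⁻¹ * y ∉ p.2 ∧ p.1⁻¹ * (n * y) ∉ p.2 := by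
    intro p hp
    have hp₂ := Finset.mem_image_of_mem Prod.snd hp
    refine ⟨hy _ hp₂ _ (Finset.mem_union_left _ (Finset.mem_image_of_mem _ hp)), ?_⟩
    have := hy _ hp₂ _
      (Finset.mem_union_right _ (Finset.mem_image_of_mem (fun p => n⁻¹ * p.1) hp))
    simpa [mul_assoc] using this
  simp only [Set.mem_sdiff, Set.mem_inter_iff, Set.mem_iUnion₂, not_exists,
    Set.mem_smul_set_iff_inv_smul_mem, smul_eq_mul, SetLike.mem_coe] at *
  refine ⟨y, hyU, ⟨⟨(hUO y hyU).1, ?_⟩, fun p hp => (hK p hp).1⟩,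
    ⟨(hUO y hyU).2, ?_⟩, fun p hp => (hK p hp).2⟩
  · simpa [mul_assoc] using M.mul_mem hy₀ hyM
  · simpa [mul_assoc] using M.mul_mem hn hyM

theorem inter_subset_closure_sdiff (hO : IsOpen O) (hJ : ∀ p ∈ J, ¬ IsLocallyFiniteIndex M p.2) :
    O ∩ closure (x • (M : Set H)) ⊆
      closure ((O ∩ x • (M : Set H)) \ ⋃ p ∈ J, p.1 • (p.2 : Set H)) := by
  refine hO.inter_closure.trans (closure_minimal ?_ isClosed_closure)
  rintro y ⟨hyO, hyM⟩
  rw [mem_closure_iff_nhds]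
  intro U hU
  obtain ⟨z, hz, hzS, -⟩ := exists_mem_sdiff_and_mul_mem_sdiff (O := O) (n := 1) hJ hyM
    (by simpa using hyM) (inter_mem hU (hO.mem_nhds hyO)) (fun y hy => ⟨hy.2, by simpa using hy.2⟩)
  exact ⟨z, hz.1, hzS⟩

/-- For `c, c'` in the coset, `β c' / β c = β (c' c⁻¹ y) / β y` for every `y` in it. When `c, c'`
are near `d`, some `y` near `y₀` has both `y` and `c' c⁻¹ y` in the piece, so continuity at `y₀`
gives the Cauchy condition at `d`. -/
theorem exists_tendsto_of_continuousOn_sdiff [LocallyCompactSpace G] {β : H → G}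
    (hβ : IsAffineOn β (x • (M : Set H))) (hO : IsOpen O)
    (hJ : ∀ p ∈ J, ¬ IsLocallyFiniteIndex M p.2)
    (hne : ((O ∩ x • (M : Set H)) \ ⋃ p ∈ J, p.1 • (p.2 : Set H)).Nonempty)
    (hcont : ContinuousOn β ((O ∩ x • (M : Set H)) \ ⋃ p ∈ J, p.1 • (p.2 : Set H)))
    {d : H} (hd : d ∈ closure (x • (M : Set H))) :
    ∃ g, Tendsto β (𝓝[x • (M : Set H)] d) (𝓝 g) := by
  have := mem_closure_iff_nhdsWithin_neBot.1 hd
  refine exists_tendsto_of_tendsto_div ?_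
  obtain ⟨y₀, hy₀⟩ := hne
  set C := x • (M : Set H) with hC
  set S := (O ∩ C) \ ⋃ p ∈ J, p.1 • (p.2 : Set H) with hS
  intro W hW
  have hdiv : Tendsto (fun p : H × H => β p.2 / β p.1) (𝓝[S] y₀ ×ˢ 𝓝[S] y₀) (𝓝 1) := by
    have h := ((hcont y₀ hy₀).tendsto.comp tendsto_snd).div'
      ((hcont y₀ hy₀).tendsto.comp (tendsto_fst (f := 𝓝[S] y₀) (g := 𝓝[S] y₀)))
    rwa [div_self'] at h
  obtain ⟨A, hA, hAW⟩ := mem_prod_same_iff.1 (Filter.mem_map.1 (hdiv hW))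
  obtain ⟨A', hA', hAS⟩ := mem_nhdsWithin_iff_exists_mem_nhds_inter.1 hA
  have hmul : Tendsto (fun p : H × H => p.1 * p.2) (𝓝 1 ×ˢ 𝓝 y₀) (𝓝 y₀) := by
    rw [← nhds_prod_eq]
    exact Continuous.tendsto' (by fun_prop) _ _ (by simp)
  obtain ⟨B, hB, B', hB', hBB⟩ := Filter.mem_prod_iff.1
    (Filter.mem_map.1 (hmul (inter_mem hA' (hO.mem_nhds hy₀.1.1))))
  have hquot : Tendsto (fun p : H × H => p.2 * p.1⁻¹) (𝓝[C] d ×ˢ 𝓝[C] d) (𝓝 1) := by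
    have h : Tendsto (fun p : H × H => p.2 * p.1⁻¹) (𝓝 d ×ˢ 𝓝 d) (𝓝 1) := by
      rw [← nhds_prod_eq]
      exact Continuous.tendsto' (by fun_prop) _ _ (by simp)
    exact h.mono_left (prod_mono nhdsWithin_le_nhds nhdsWithin_le_nhds)
  have hmemC : C ×ˢ C ∈ 𝓝[C] d ×ˢ 𝓝[C] d := prod_mem_prod self_mem_nhdsWithin self_mem_nhdsWithin
  rw [Filter.mem_map]
  filter_upwards [hquot hB, hmemC] with ⟨c, c'⟩ hcB ⟨hc, hc'⟩
  have hcos : IsCosetSet C := ⟨x, M, rfl⟩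
  have hBmem : ∀ y ∈ B', c' * c⁻¹ * y ∈ A' ∩ O := fun y hy =>
    @hBB (c' * c⁻¹, y) (Set.mk_mem_prod hcB hy)
  obtain ⟨y, hyU, hyS, hnyS⟩ := exists_mem_sdiff_and_mul_mem_sdiff (O := O) (n := c' * c⁻¹)
    hJ hy₀.1.2 (hcos.mul_inv_mul_mem hc' hc hy₀.1.2)
    (inter_mem hB' (inter_mem hA' (hO.mem_nhds hy₀.1.1)))
    (fun y hy => ⟨hy.2.2, (hBmem y hy.1).2⟩)
  have hW' : β (c' * c⁻¹ * y) / β y ∈ W :=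
    @hAW (y, c' * c⁻¹ * y) (Set.mk_mem_prod (hAS ⟨hyU.2.1, hyS⟩)
      (hAS ⟨(hBmem y hyU.1).1, hnyS⟩))
  rw [hβ c' hc' c hc y hyS.1.2] at hW'
  simpa [div_eq_mul_inv] using hW'

theorem isAffineOn_closure_extendFrom [T2Space G] {β : H → G} {C : Set H} (hC : IsCosetSet C)
    (hβ : IsAffineOn β C) (hlim : ∀ d ∈ closure C, ∃ g, Tendsto β (𝓝[C] d) (𝓝 g)) :
    IsAffineOn (extendFrom C β) (closure C) := by
  intro r hr s hs t ht
  have := mem_closure_iff_nhdsWithin_neBot.1 hr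
  have := mem_closure_iff_nhdsWithin_neBot.1 hs
  have := mem_closure_iff_nhdsWithin_neBot.1 ht
  have hmem : ∀ᶠ p : H × H × H in 𝓝[C] r ×ˢ 𝓝[C] s ×ˢ 𝓝[C] t, p.1 ∈ C ∧ p.2.1 ∈ C ∧ p.2.2 ∈ C :=
    prod_mem_prod self_mem_nhdsWithin (prod_mem_prod self_mem_nhdsWithin self_mem_nhdsWithin)
  have hu : Tendsto (fun p : H × H × H => p.1 * p.2.1⁻¹ * p.2.2)
      (𝓝[C] r ×ˢ 𝓝[C] s ×ˢ 𝓝[C] t) (𝓝[C] (r * s⁻¹ * t)) := by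
    refine tendsto_nhdsWithin_iff.2 ⟨?_, hmem.mono fun p hp => hC.mul_inv_mul_mem hp.1 hp.2.1 hp.2.2⟩
    have h : Tendsto (fun p : H × H × H => p.1 * p.2.1⁻¹ * p.2.2)
        (𝓝 r ×ˢ 𝓝 s ×ˢ 𝓝 t) (𝓝 (r * s⁻¹ * t)) := by
      rw [← nhds_prod_eq, ← nhds_prod_eq]
      exact Continuous.tendsto (by fun_prop) (r, s, t)
    exact h.mono_left (prod_mono nhdsWithin_le_nhds (prod_mono nhdsWithin_le_nhds
      nhdsWithin_le_nhds))
  have hru : r * s⁻¹ * t ∈ closure C :=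
    mem_closure_iff_nhdsWithin_neBot.2 (NeBot.mono (map_neBot) hu)
  have h₁ := (tendsto_extendFrom (hlim _ hru)).comp hu
  have h₂ := (((tendsto_extendFrom (hlim r hr)).comp
      (tendsto_fst (f := 𝓝[C] r) (g := 𝓝[C] s ×ˢ 𝓝[C] t))).mul
    (((tendsto_extendFrom (hlim s hs)).comp
      (tendsto_fst (f := 𝓝[C] s) (g := 𝓝[C] t))).comp tendsto_snd).inv).mul
    (((tendsto_extendFrom (hlim t ht)).comp
      (tendsto_snd (f := 𝓝[C] s) (g := 𝓝[C] t))).comp tendsto_snd)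
  refine tendsto_nhds_unique (h₁.congr' (hmem.mono fun p hp => ?_)) h₂
  exact hβ _ hp.1 _ hp.2.1 _ hp.2.2

end

/-! ### Covering `Y` by the open coset ring. -/

theorem isClopen_of_mem_openCosetRing {H : Type*} [Group H] [TopologicalSpace H]
    [IsTopologicalGroup H] {X : Set H} (hX : X ∈ openCosetRing H) : IsClopen X := by
  induction hX with
  | base C hC =>
    obtain ⟨⟨x, M, rfl⟩, hopen⟩ := hC
    have hM : IsOpen (M : Set H) := by simpa using hopen.smul x⁻¹
    exact ⟨(M.isClosed_of_isOpen hM).smul x, hopen⟩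
  | empty => exact isClopen_empty
  | compl _ _ ih => exact ih.compl
  | union _ _ _ _ ih ih' => exact ih.union ih'

/-- Each reduced piece on which `α` is affine is, up to a nowhere dense set, contained in a set of
the open coset ring on which `α` is given by a continuous affine map. -/
theorem IsReducedPiece.exists_openCosetRing {H G : Type*} [Group H] [TopologicalSpace H]
    [IsTopologicalGroup H] [Group G] [TopologicalSpace G] [IsTopologicalGroup G]
    [LocallyCompactSpace G] [T2Space G] {α : H → OnePoint G} (hα : Continuous α) {E S : Set H}
    (hS : IsReducedPiece E S) {β : H → G} (hβ : IsAffineOn β E)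
    (hαβ : ∀ y ∈ S, α y = (β y : OnePoint G)) :
    ∃ Z ∈ openCosetRing H, ∃ D, IsCosetSet D ∧ Z ⊆ D ∧
      (∃ γ : H → G, ContinuousOn γ D ∧ IsAffineOn γ D ∧ ∀ y ∈ Z, α y = (γ y : OnePoint G)) ∧
      ∃ N : Set H, IsClosed N ∧ interior N = ∅ ∧ S ⊆ Z ∪ N := by
  have hA := MeasureTheory.isSetAlgebra_generateSetAlgebra
    (𝒜 := {C : Set H | IsCosetSet C ∧ IsOpen C})
  have htriv : ∀ N : Set H, IsClosed N → interior N = ∅ → S ⊆ N →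
      ∃ Z ∈ openCosetRing H, ∃ D, IsCosetSet D ∧ Z ⊆ D ∧
      (∃ γ : H → G, ContinuousOn γ D ∧ IsAffineOn γ D ∧ ∀ y ∈ Z, α y = (γ y : OnePoint G)) ∧
      ∃ N : Set H, IsClosed N ∧ interior N = ∅ ∧ S ⊆ Z ∪ N := fun N hN hNi hSN =>
    ⟨∅, hA.empty_mem, Set.univ, .univ, Set.empty_subset _,
      ⟨fun _ => 1, continuousOn_const, fun _ _ _ _ _ _ => by simp, by simp⟩, N, hN, hNi,
      by simpa using hSN⟩
  rcases S.eq_empty_or_nonempty with rfl | hne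
  · exact htriv ∅ isClosed_empty interior_empty subset_rfl
  obtain ⟨O, hO, x, M, J, hME, rfl, hJ⟩ := hS
  have hOo := (isClopen_of_mem_openCosetRing hO).isOpen
  by_cases hM : IsOpen (closure (M : Set H))
  · replace hJ := hJ hM
    have hβC := hβ.mono hME
    have hcos : IsCosetSet (closure (x • (M : Set H))) :=
      ⟨x, M.topologicalClosure, closure_smul x _⟩
    have hopen : IsOpen (closure (x • (M : Set H))) := by
      rw [closure_smul]
      exact hM.smul x
    set S := (O ∩ x • (M : Set H)) \ ⋃ p ∈ J, p.1 • (p.2 : Set H) with hS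
    have hcont : ContinuousOn β S := by
      rw [OnePoint.isOpenEmbedding_coe.isInducing.continuousOn_iff]
      exact hα.continuousOn.congr fun y hy => (hαβ y hy).symm
    have hlim := fun d hd => exists_tendsto_of_continuousOn_sdiff (d := d) hβC hOo hJ hne hcont hd
    refine ⟨O ∩ closure (x • (M : Set H)), hA.inter_mem hO
      (MeasureTheory.self_subset_generateSetAlgebra ⟨hcos, hopen⟩), _, hcos,
      Set.inter_subset_right, ⟨extendFrom (x • (M : Set H)) β,
        continuousOn_extendFrom subset_rfl hlim,
        isAffineOn_closure_extendFrom ⟨x, M, rfl⟩ hβC hlim, ?_⟩, ∅, isClosed_empty,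
      interior_empty, ?_⟩
    · intro y hy
      have := mem_closure_iff_nhdsWithin_neBot.1 (inter_subset_closure_sdiff hOo hJ hy)
      have h₁ : Tendsto α (𝓝[S] y) (𝓝 (α y)) := hα.continuousAt.tendsto.mono_left nhdsWithin_le_nhds
      have h₂ := (OnePoint.continuous_coe.tendsto _).comp
        ((tendsto_extendFrom (hlim y hy.2)).mono_left
          (nhdsWithin_mono y (show S ⊆ x • (M : Set H) from fun z hz => hz.1.2)))
      -- Limits in `OnePoint G` are unique since `G` is locally compact Hausdorff; thus `α` cannot
      -- take the value `∞` at `y`.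
      refine tendsto_nhds_unique h₁ (h₂.congr' ?_)
      filter_upwards [self_mem_nhdsWithin] with z hz
      exact (hαβ z hz).symm
    · rw [Set.union_empty]
      exact fun z hz => ⟨hz.1.1, subset_closure hz.1.2⟩
  · refine htriv (closure (x • (M : Set H))) isClosed_closure ?_
      fun z hz => subset_closure hz.1.2
    by_contra hint
    exact hM (isOpen_closure_of_interior_smul M x (Set.nonempty_iff_ne_empty.2 hint))

/-- A finite union of members of the open coset ring is a disjoint union of nonempty members of the
open coset ring, each of which is contained in one of the given sets. -/
theorem exists_disjoint_openCosetRing {H : Type*} [Group H] [TopologicalSpace H]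
    {F : Set (Set H)} (hF : F.Finite) (hFo : ∀ Z ∈ F, Z ∈ openCosetRing H) :
    ∃ (m : ℕ) (P : Fin m → Set H), (∀ i, P i ∈ openCosetRing H) ∧ (∀ i, (P i).Nonempty) ∧
      Pairwise (fun i j => Disjoint (P i) (P j)) ∧ ⋃₀ F = ⋃ i, P i ∧
      ∀ i, ∃ Z ∈ F, P i ⊆ Z := by
  classical
  have hA := MeasureTheory.isSetAlgebra_generateSetAlgebra
    (𝒜 := {C : Set H | IsCosetSet C ∧ IsOpen C})
  induction F, hF using Set.Finite.induction_on with
  | empty => exact ⟨0, Fin.elim0, fun i => i.elim0, fun i => i.elim0, fun i => i.elim0, by simp,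
      fun i => i.elim0⟩
  | @insert Z F _ _ ih =>
    obtain ⟨m, P, hP, hne, hdisj, hU, hsub⟩ := ih fun Z hZ => hFo Z (Set.mem_insert_of_mem _ hZ)
    have hZ := hFo Z (Set.mem_insert _ _)
    have hsub' : ∀ i, ∃ Z' ∈ insert Z F, P i ⊆ Z' := fun i =>
      (hsub i).imp fun Z' h => ⟨Set.mem_insert_of_mem _ h.1, h.2⟩
    rcases (Z \ ⋃ i, P i).eq_empty_or_nonempty with hemp | hZne
    · refine ⟨m, P, hP, hne, hdisj, ?_, hsub'⟩
      rw [Set.sUnion_insert, hU, Set.union_eq_right]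
      exact Set.sdiff_eq_empty.1 hemp
    · have hUo : (⋃ i, P i) ∈ openCosetRing H := by
        have h := hA.biUnion_mem Finset.univ fun i _ => hP i
        simp only [Finset.mem_univ, Set.iUnion_true] at h
        exact h
      refine ⟨m + 1, Fin.cons (Z \ ⋃ i, P i) P, ?_, ?_, ?_, ?_, ?_⟩
      · exact Fin.cases (hA.sdiff_mem hZ hUo) hP
      · exact Fin.cases hZne hne
      · have h0 : ∀ i, Disjoint (Z \ ⋃ i, P i) (P i) := fun i =>
          Set.disjoint_sdiff_left.mono_right (Set.subset_iUnion P i)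
        intro i j hij
        induction i using Fin.cases with
        | zero =>
          induction j using Fin.cases with
          | zero => exact (hij rfl).elim
          | succ j => exact h0 j
        | succ i =>
          induction j using Fin.cases with
          | zero => exact (h0 i).symm
          | succ j => exact hdisj fun h => hij (congrArg Fin.succ h)
      · rw [Set.sUnion_insert, hU]
        ext y
        simp only [Set.mem_union, Set.mem_iUnion, Fin.exists_fin_succ, Fin.cons_zero, Fin.cons_succ,
          Set.mem_sdiff]
        tauto
      · exact Fin.cases ⟨Z, Set.mem_insert _ _, Set.sdiff_subset⟩ hsub'

theorem exists_openCosetRing_cover {H G : Type*} [Group H] [TopologicalSpace H]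
    [IsTopologicalGroup H] [Group G] [TopologicalSpace G] [IsTopologicalGroup G]
    [LocallyCompactSpace G] [T2Space G] {α : H → OnePoint G} (hα : Continuous α) {Y : Set H}
    (hY : Y = {h : H | α h ≠ OnePoint.infty}) {a : Y → G}
    (ha : ∀ y : Y, α (y : H) = ((a y : G) : OnePoint G)) (hpw : IsPiecewiseAffine a) :
    ∃ F : Set (Set H), F.Finite ∧ Y = ⋃₀ F ∧ ∀ Z ∈ F, Z ∈ openCosetRing H ∧
      ∃ D, IsCosetSet D ∧ Z ⊆ D ∧ ∃ γ : H → G, ContinuousOn γ D ∧ IsAffineOn γ D ∧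
        ∀ y ∈ Z, α y = (γ y : OnePoint G) := by
  classical
  obtain ⟨n, P, hP, -, hYP, hβ⟩ := hpw
  have hpiece : ∀ i, ∃ F : Set (Set H), F.Finite ∧ P i = ⋃₀ F ∧ ∀ S ∈ F,
      ∃ Z ∈ openCosetRing H, ∃ D, IsCosetSet D ∧ Z ⊆ D ∧
      (∃ γ : H → G, ContinuousOn γ D ∧ IsAffineOn γ D ∧ ∀ y ∈ Z, α y = (γ y : OnePoint G)) ∧
      ∃ N : Set H, IsClosed N ∧ interior N = ∅ ∧ S ⊆ Z ∪ N := by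
    intro i
    rcases (P i).eq_empty_or_nonempty with hemp | hne
    · exact ⟨∅, Set.finite_empty, by simp [hemp], by simp⟩
    obtain ⟨hcos, hsub⟩ := (isLeast_affHull hne).1
    obtain ⟨β, hβaff, hβa⟩ := hβ i
    set f : H → G := fun h => if hh : h ∈ affHull (P i) then β ⟨h, hh⟩ else 1 with hf
    have hfβ : ∀ c : affHull (P i), f c = β c := fun c => by simp [hf]
    obtain ⟨F, hF, hred, hU⟩ := hasReducedDecomposition_of_mem_cosetRing (hP i) hcos hsub
    refine ⟨F, hF, hU, fun S hS => (hred S hS).exists_openCosetRing hα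
      (hβaff.isAffineOn hcos hfβ) fun y hy => ?_⟩
    have hyP : y ∈ P i := hU ▸ Set.mem_sUnion_of_mem hy hS
    have hyY : y ∈ Y := hYP ▸ Set.mem_iUnion_of_mem i hyP
    rw [ha ⟨y, hyY⟩, hβa y hyY hyP, ← hfβ]
  choose F hF hU Z hZ D hD hZD hγ N hNc hNi hSN using hpiece
  let s : Finset (Σ i, F i) := by
    have := fun i => (hF i).fintype
    exact Finset.univ
  have hs : ∀ p, p ∈ s := fun p => by simp [s]
  refine ⟨⋃ p : Σ i, F i, {Z p.1 p.2 p.2.2}, ?_, ?_, ?_⟩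
  · have := fun i => (hF i).to_subtype
    exact Set.finite_iUnion fun _ => Set.finite_singleton _
  · rw [Set.sUnion_iUnion]
    simp only [Set.sUnion_singleton]
    have hYopen : IsOpen Y := by
      rw [hY]
      exact isClosed_singleton.isOpen_compl.preimage hα
    have hUclosed : IsClosed (⋃ p : Σ i, F i, Z p.1 p.2 p.2.2) := by
      have := fun i => (hF i).to_subtype
      exact isClosed_iUnion_of_finite fun p => (isClopen_of_mem_openCosetRing (hZ _ _ _)).isClosed
    refine Set.Subset.antisymm ?_ (Set.iUnion_subset fun p y hy => ?_)
    -- The leftover is open and lies in the finite union of the closed sets `N`, all with empty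
    -- interior.
    · rw [← Set.sdiff_eq_empty]
      by_contra hne
      obtain ⟨p, -, hp⟩ := exists_interior_nonempty_of_subset_biUnion s
        (F := fun p => N p.1 p.2 p.2.2) (fun p _ => hNc _ _ _) (hYopen.sdiff hUclosed)
        (Set.nonempty_iff_ne_empty.2 hne) (by
          rintro y ⟨hyY, hyZ⟩
          rw [hYP, Set.mem_iUnion] at hyY
          obtain ⟨i, hyi⟩ := hyY
          rw [hU i] at hyi
          obtain ⟨S, hS, hyS⟩ := hyi
          rcases hSN i S hS hyS with h | h
          · exact (hyZ (Set.mem_iUnion.2 ⟨⟨i, S, hS⟩, h⟩)).elim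
          · exact Set.mem_iUnion₂.2 ⟨⟨i, S, hS⟩, hs _, h⟩)
      exact hp.ne_empty (hNi _ _ _)
    · obtain ⟨γ, -, -, hγ⟩ := hγ p.1 p.2 p.2.2
      rw [hY, Set.mem_ofPred_eq, hγ y hy]
      exact OnePoint.coe_ne_infty _
  · intro W hW
    obtain ⟨p, rfl⟩ := Set.mem_iUnion.1 hW
    exact ⟨hZ _ _ _, D _ _ _, hD _ _ _, hZD _ _ _, hγ _ _ _⟩

theorem proposition4p6 {H G : Type*}
    [Group H] [TopologicalSpace H] [IsTopologicalGroup H] [LocallyCompactSpace H] [T2Space H]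
    [SigmaCompactSpace H]
    [Group G] [TopologicalSpace G] [IsTopologicalGroup G] [LocallyCompactSpace G] [T2Space G]
    (α : H → OnePoint G) (hα : Continuous α)
    (Y : Set H) (hY : Y = {h : H | α h ≠ OnePoint.infty})
    (a : Y → G) (ha : ∀ y : Y, α (y : H) = ((a y : G) : OnePoint G))
    (hpw : IsPiecewiseAffine a) :
    ∃ (m : ℕ) (P : Fin m → Set H),
      (∀ i, P i ∈ openCosetRing H) ∧ (∀ i, (P i).Nonempty) ∧
      Pairwise (fun i j => Disjoint (P i) (P j)) ∧ Y = ⋃ i, P i ∧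
      ∀ i, ∃ β : affHull (P i) → G, Continuous β ∧ IsAffineMap β ∧
        ∀ (y : H) (hy : y ∈ Y) (hP : y ∈ P i), a ⟨y, hy⟩ = β ⟨y, subset_affHull _ hP⟩ := by
  obtain ⟨F, hF, hYF, hFZ⟩ := exists_openCosetRing_cover hα hY ha hpw
  obtain ⟨m, P, hP, hne, hdisj, hU, hsub⟩ := exists_disjoint_openCosetRing hF
    fun Z hZ => (hFZ Z hZ).1
  refine ⟨m, P, hP, hne, hdisj, hYF.trans hU, fun i => ?_⟩
  obtain ⟨Z, hZ, hPZ⟩ := hsub i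
  obtain ⟨-, D, hD, hZD, γ, hγc, hγa, hγα⟩ := hFZ Z hZ
  -- Disjointification may shrink the hull, but it stays inside the coset `D` on which `γ` is affine
  -- and continuous.
  have hhull : affHull (P i) ⊆ D := (isLeast_affHull (hne i)).2 ⟨hD, hPZ.trans hZD⟩
  refine ⟨fun h => γ h, (hγc.mono hhull).domRestrict, ?_, fun y hy hyP => ?_⟩
  · intro r s t u hu
    dsimp only
    rw [hu]
    exact hγa r (hhull r.2) s (hhull s.2) t (hhull t.2)
  · exact OnePoint.coe_injective ((ha ⟨y, hy⟩).symm.trans (hγα y (hPZ hyP)))
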